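/- Consider a time-slotted system in which $N$ terminals send status packets to a base station over a shared uplink. In every slot, at most one packet arrives at terminal $n$, with probability $\lambda_n\in(0,1]$, independently over terminals and slots; arriving packets are stored in a queue of size $B\ge 1$ (possibly infinite). At the beginning of each slot a policy decides which terminals are scheduled and which queued packet each of them transmits; a transmission succeeds if and only if no other terminal is scheduled in the same slot. New packets, of age $0$, arrive after the transmission, the policy may drop packets from the queues, and finally all ages increase by one. The age of information (AoI) $h_{n,\pi}(t)$ of terminal $n$ under the policy $\pi$ starts from an arbitrary initial value, drops to the age of the delivered packet at a successful update (if that packet is fresher than the status held by the base station), and increases by one in every slot. The time-average AoI of $\pi$ is $$\bar h^{(\infty,N)}_{\pi}=\limsup_{T\to\infty}\ \mathbb E\Big[\frac1{TN}\sum_{t=1}^{T}\sum_{n=1}^{N}h_{n,\pi}(t)\Big],$$ and $\bar h^{(\infty,N)}_{\mathrm{opt}}=\inf_\pi \bar h^{(\infty,N)}_{\pi}$ is the minimum time-average AoI over all causal, possibly randomized, policies. Let $\lambda_1,\lambda_2,\dots\in(0,1]$ be a fixed sequence of arrival rates such that $\frac1N\sum_{n=1}^N\frac1{\lambda_n}=o(N)$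 as $N\to\infty$ (for instance, rates bounded away from $0$). Then the minimum time-average AoI grows asymptotically linearly in the number of terminals, with optimal scaling factor $\frac12$: $$\lim_{N\to\infty}\frac{\bar h^{(\infty,N)}_{\mathrm{opt}}}{N}=\frac12 .$$ The same holds if the minimum is taken over all policies, including non-causal ones that know the future arrivals. -/

import Mathlib

open MeasureTheory ProbabilityTheory Filter Topology
open scoped ENNReal

namespace AoI

/-- The decisions of a scheduling and packet-management policy for `N` terminals, as stochastic
processes on `Ω`. Slot `t = 0, 1, 2, ...` leads from time `t` to time `t + 1`.
A packet is identified by the slot in which it arrived (at most one per slot and terminal). -/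
structure Policy (N : ℕ) (Ω : Type*) where
  /-- `sched n t` tells whether terminal `n` is scheduled in slot `t`. -/
  sched : Fin N → ℕ → Ω → Bool
  /-- `packet n t` is the packet that terminal `n` picks for transmission in slot `t`; nothing is
  transmitted if this packet is not in the queue. -/
  packet : Fin N → ℕ → Ω → ℕ
  /-- `keep n t` consists of the packets that terminal `n` does not drop in slot `t`. -/
  keep : Fin N → ℕ → Ω → Set ℕ

namespace Policy

variable {N : ℕ} {Ω : Type*}

/-- Terminal `n` is scheduled in slot `t` and no other terminal is (there is no collision). -/
def Success (π : Policy N Ω) (n : Fin N) (t : ℕ) (ω : Ω) : Prop :=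
  π.sched n t ω = true ∧ ∀ m, m ≠ n → π.sched m t ω = false

/-- The queue of terminal `n` at time `t` (the beginning of slot `t`), for arrivals `L`; it is empty
at time `0`. In each slot the packet that is delivered leaves the queue, then the packet arriving in
this slot (if any) joins, and the packets that are not kept are dropped. -/
def queue (π : Policy N Ω) (L : Fin N → ℕ → Ω → Bool) (n : Fin N) : ℕ → Ω → Set ℕ
  | 0, _ => ∅
  | t + 1, ω =>
    {s | ((s ∈ queue π L n t ω ∧ ¬ (π.Success n t ω ∧ π.packet n t ω = s)) ∨
        (s = t ∧ L n t ω = true)) ∧ s ∈ π.keep n t ω}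

open Classical in
/-- The AoI reduction achieved by a successful update of terminal `n` in slot `t`, when the AoI is
`h`. The packet that arrived in slot `s` has age zero on arrival, hence age `t - s` at time `t`.
The reduction is zero if no packet is sent or if the packet is older than the status
at the base station (truncated subtraction). -/
noncomputable def gain (π : Policy N Ω) (L : Fin N → ℕ → Ω → Bool) (n : Fin N) (t : ℕ) (ω : Ω)
    (h : ℕ) : ℕ :=
  if π.packet n t ω ∈ π.queue L n t ω then h - (t - π.packet n t ω) else 0

open Classical in
/-- The AoI of terminal `n` at time `t`, with initial value `h₀ n`. -/
noncomputable def aoi (π : Policy N Ω) (L : Fin N → ℕ → Ω → Bool) (h₀ : Fin N → ℕ) (n : Fin N) :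
    ℕ → Ω → ℕ
  | 0, _ => h₀ n
  | t + 1, ω =>
    aoi π L h₀ n t ω
      - (if π.Success n t ω then π.gain L n t ω (aoi π L h₀ n t ω) else 0) + 1

/-- The `T`-horizon time-average AoI along a sample path, averaged over the terminals as well. -/
noncomputable def avgAoI (π : Policy N Ω) (L : Fin N → ℕ → Ω → Bool) (h₀ : Fin N → ℕ) (T : ℕ)
    (ω : Ω) : ℝ≥0∞ :=
  (∑ t ∈ Finset.Icc 1 T, ∑ n : Fin N, (π.aoi L h₀ n t ω : ℝ≥0∞)) / ((T : ℝ≥0∞) * (N : ℝ≥0∞))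

/-- The (infinite-horizon, expected) time-average AoI. The upper limit is the limit whenever the
latter exists; the value is `∞` for policies under which the averages grow without bound. -/
noncomputable def timeAvgAoI [MeasurableSpace Ω] (π : Policy N Ω) (μ : Measure Ω)
    (L : Fin N → ℕ → Ω → Bool) (h₀ : Fin N → ℕ) : ℝ≥0∞ :=
  limsup (fun T : ℕ => ∫⁻ ω, π.avgAoI L h₀ T ω ∂μ) atTop

/-- No queue ever holds more than `B` packets. -/
def RespectsBuffer (π : Policy N Ω) (L : Fin N → ℕ → Ω → Bool) (B : ℕ∞) : Prop :=
  ∀ n t ω, (π.queue L n t ω).encard ≤ B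

/-- Scheduling and packet selection in slot `t` take place at the beginning of the slot and use the
information `𝓕 t`; packets are dropped at the end of the slot, with the information `𝓕 (t + 1)`. -/
def UsesInfo (π : Policy N Ω) (𝓕 : ℕ → MeasurableSpace Ω) : Prop :=
  ∀ n t, Measurable[𝓕 t] (π.sched n t) ∧ Measurable[𝓕 t] (π.packet n t) ∧
    ∀ s, MeasurableSet[𝓕 (t + 1)] {ω | s ∈ π.keep n t ω}

/-- A causal, possibly randomized policy: the information used at time `t` contains all arrivals
before slot `t` and is independent of the arrivals in the slots from `t` on. -/
def Causal [mΩ : MeasurableSpace Ω] (π : Policy N Ω) (μ : Measure Ω)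
    (L : Fin N → ℕ → Ω → Bool) : Prop :=
  ∃ 𝓕 : Filtration ℕ mΩ,
    (∀ n s t, s < t → Measurable[𝓕 t] (L n s)) ∧
    (∀ t, Indep (𝓕 t)
      (⨆ n : Fin N, ⨆ s : ℕ, ⨆ _ : t ≤ s, MeasurableSpace.comap (L n s) inferInstance) μ) ∧
    π.UsesInfo 𝓕

/-- Any measurable decisions whatsoever are allowed: they may be randomized and may depend on all
arrivals, including the future ones. -/
def Arbitrary [mΩ : MeasurableSpace Ω] (π : Policy N Ω) : Prop :=
  π.UsesInfo (fun _ => mΩ)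

end Policy

/-- The minimum time-average AoI over all causal policies with buffers of size `B`. -/
noncomputable def minAoI {Ω : Type*} [MeasurableSpace Ω] (μ : Measure Ω) (N : ℕ)
    (L : Fin N → ℕ → Ω → Bool) (h₀ : Fin N → ℕ) (B : ℕ∞) : ℝ≥0∞ :=
  ⨅ π : {π : Policy N Ω // π.RespectsBuffer L B ∧ π.Causal μ L}, π.1.timeAvgAoI μ L h₀

/-- The minimum time-average AoI over all policies with buffers of size `B`, including those that
know the future arrivals. -/
noncomputable def minAoINonCausal {Ω : Type*} [MeasurableSpace Ω] (μ : Measure Ω) (N : ℕ)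
    (L : Fin N → ℕ → Ω → Bool) (h₀ : Fin N → ℕ) (B : ℕ∞) : ℝ≥0∞ :=
  ⨅ π : {π : Policy N Ω // π.RespectsBuffer L B ∧ π.Arbitrary}, π.1.timeAvgAoI μ L h₀

end AoI

/-! The lower bound is a pathwise counting argument. A slot serves at most one terminal and an AoI
is at least 1 after any slot, so an AoI of at most `k` at time `t > k` forces a success in the last
`k` slots. Hence at most `k` terminals have AoI at most `k` (`Policy.card_aoi_le`), and the AoIs sum
to at least `1 + ... + N`, whatever the policy knows.

For the upper bound, `roundRobin` has AoI at most the time since the last service plus the age of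
the freshest packet at that service (`roundRobin_aoi_le`). The service times sum to exactly `1 + ...
+ N`, and the fresh ages have mean at most `1 / rate n` plus a vanishing transient
(`lintegral_freshAge_le`).

Divided by `N` twice, the bounds differ by the `o(N)` mean of `1 / rate n` over `N`. Both minima lie
between them because `roundRobin` is causal. -/

namespace AoI

namespace Policy

variable {N : ℕ} {Ω : Type*}

/-! ### Lower bound: at most one update per slot -/

theorem Success.unique {π : Policy N Ω} {n m : Fin N} {t : ℕ} {ω : Ω}
    (hn : π.Success n t ω) (hm : π.Success m t ω) : n = m := by
  by_contra hne
  have h := hm.2 n hne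
  rw [hn.1] at h
  exact Bool.noConfusion h

theorem aoi_succ_le (π : Policy N Ω) (L : Fin N → ℕ → Ω → Bool) (h₀ : Fin N → ℕ) (n : Fin N)
    (t : ℕ) (ω : Ω) : π.aoi L h₀ n (t + 1) ω ≤ π.aoi L h₀ n t ω + 1 := by
  simp only [aoi]
  omega

theorem aoi_succ_pos (π : Policy N Ω) (L : Fin N → ℕ → Ω → Bool) (h₀ : Fin N → ℕ) (n : Fin N)
    (t : ℕ) (ω : Ω) : 0 < π.aoi L h₀ n (t + 1) ω := by
  simp only [aoi]
  omega

theorem aoi_succ_of_not_success {π : Policy N Ω} {L : Fin N → ℕ → Ω → Bool} {h₀ : Fin N → ℕ}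
    {n : Fin N} {t : ℕ} {ω : Ω} (h : ¬ π.Success n t ω) :
    π.aoi L h₀ n (t + 1) ω = π.aoi L h₀ n t ω + 1 := by
  simp [aoi, h]

theorem aoi_succ_of_success {π : Policy N Ω} {L : Fin N → ℕ → Ω → Bool} {h₀ : Fin N → ℕ}
    {n : Fin N} {t : ℕ} {ω : Ω} (h : π.Success n t ω) (hq : π.packet n t ω ∈ π.queue L n t ω) :
    π.aoi L h₀ n (t + 1) ω = min (π.aoi L h₀ n t ω) (t - π.packet n t ω) + 1 := by
  simp only [aoi, gain, if_pos h, if_pos hq]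
  omega

theorem aoi_add_of_no_success {π : Policy N Ω} {L : Fin N → ℕ → Ω → Bool} {h₀ : Fin N → ℕ}
    {n : Fin N} {s : ℕ} {ω : Ω} (k : ℕ) (h : ∀ u, s ≤ u → u < s + k → ¬ π.Success n u ω) :
    π.aoi L h₀ n (s + k) ω = π.aoi L h₀ n s ω + k := by
  induction k with
  | zero => rfl
  | succ k ih =>
    rw [← add_assoc, aoi_succ_of_not_success (h (s + k) (by omega) (by omega)),
      ih fun u h1 h2 => h u h1 (by omega), add_assoc]

/-- Without a success, the AoI grows by `k` from time `t - k`. The condition `k < t` makes `t - k`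
the end of a slot, where the AoI is positive; the initial AoI may be 0. -/
theorem exists_success_of_aoi_le {π : Policy N Ω} {L : Fin N → ℕ → Ω → Bool} {h₀ : Fin N → ℕ}
    {n : Fin N} {t k : ℕ} {ω : Ω} (hk : k < t) (h : π.aoi L h₀ n t ω ≤ k) :
    ∃ u ∈ Finset.Ico (t - k) t, π.Success n u ω := by
  by_contra! hno
  obtain ⟨s, rfl⟩ : ∃ s, t = s + 1 + k := ⟨t - k - 1, by omega⟩
  have h1 := aoi_add_of_no_success (L := L) (h₀ := h₀) (s := s + 1) (n := n) (ω := ω) k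
    (fun u h1 h2 => hno u (Finset.mem_Ico.2 ⟨by omega, h2⟩))
  have h2 := aoi_succ_pos π L h₀ n s ω
  omega

/-- Each such terminal picks one of its successes among the last `k` slots; distinct terminals pick
distinct slots. -/
theorem card_aoi_le (π : Policy N Ω) (L : Fin N → ℕ → Ω → Bool) (h₀ : Fin N → ℕ) {t k : ℕ}
    (hk : k < t) (ω : Ω) : (Finset.univ.filter fun n => π.aoi L h₀ n t ω ≤ k).card ≤ k := by
  choose! f hf using fun (n : Fin N) (hn : π.aoi L h₀ n t ω ≤ k) =>
    exists_success_of_aoi_le hk hn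
  calc _ ≤ (Finset.Ico (t - k) t).card := by
        refine Finset.card_le_card_of_injOn f ?_ ?_
        · intro n hn
          exact (hf n (by simpa using hn)).1
        · intro n hn m hm hnm
          have h1 := (hf n (by simpa using hn)).2
          have h2 := (hf m (by simpa using hm)).2
          rw [hnm] at h1
          exact h1.unique h2
    _ = k := by rw [Nat.card_Ico]; omega

theorem sum_sub_range_mul_two (N : ℕ) : (∑ k ∈ Finset.range N, (N - k)) * 2 = N * (N + 1) := by
  rw [← Finset.sum_range_reflect,
    Finset.sum_congr rfl (g := fun k => k + 1) fun k hk => by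
      have := Finset.mem_range.1 hk
      omega]
  have h := Finset.sum_range_id_mul_two (N + 1)
  rw [Finset.sum_range_succ'] at h
  simpa [mul_comm] using h

/-- Layer-cake count: an AoI is at least the number of `k < N` below it, and each level `k` is
exceeded by at least `N - k` terminals. -/
theorem le_sum_aoi (π : Policy N Ω) (L : Fin N → ℕ → Ω → Bool) (h₀ : Fin N → ℕ) {t : ℕ}
    (ht : N ≤ t) (ω : Ω) : N * (N + 1) ≤ (∑ n, π.aoi L h₀ n t ω) * 2 := by
  rw [← sum_sub_range_mul_two]
  refine Nat.mul_le_mul_right _ ?_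
  calc ∑ k ∈ Finset.range N, (N - k)
      ≤ ∑ k ∈ Finset.range N, ∑ n : Fin N, if k < π.aoi L h₀ n t ω then 1 else 0 := by
        refine Finset.sum_le_sum fun k hk => ?_
        have h1 := card_aoi_le π L h₀ ((Finset.mem_range.1 hk).trans_le ht) ω
        have h2 := Finset.card_filter_add_card_filter_not (s := (Finset.univ : Finset (Fin N)))
          (fun n => π.aoi L h₀ n t ω ≤ k)
        simp only [not_le, Finset.card_univ, Fintype.card_fin] at h2
        rw [← Finset.card_filter]
        omega
    _ = ∑ n : Fin N, ∑ k ∈ Finset.range N, if k < π.aoi L h₀ n t ω then 1 else 0 :=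
        Finset.sum_comm
    _ ≤ ∑ n, π.aoi L h₀ n t ω := by
        refine Finset.sum_le_sum fun n _ => ?_
        rw [← Finset.card_filter]
        calc _ ≤ (Finset.range (π.aoi L h₀ n t ω)).card :=
              Finset.card_le_card fun k hk => by simpa using (Finset.mem_filter.1 hk).2
          _ = _ := Finset.card_range _

/-- The first `N` times are discarded, which costs the factor `(T - N) / T`; for `T ≤ N` the bound
is trivial. -/
theorem le_avgAoI (π : Policy N Ω) (L : Fin N → ℕ → Ω → Bool) (h₀ : Fin N → ℕ) (hN : 0 < N)
    {T : ℕ} (hT : 0 < T) (ω : Ω) :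
    ENNReal.ofReal (((T : ℝ) - N) / T * ((N + 1) / 2)) ≤ π.avgAoI L h₀ T ω := by
  have hN' : (0 : ℝ) < N := by exact_mod_cast hN
  have hT' : (0 : ℝ) < T := by exact_mod_cast hT
  have key : ((T : ℝ) - N) * (N * (N + 1) / 2)
      ≤ ((∑ t ∈ Finset.Icc 1 T, ∑ n : Fin N, π.aoi L h₀ n t ω : ℕ) : ℝ) := by
    rcases le_total T N with h | h
    · have : (T : ℝ) ≤ N := by exact_mod_cast h
      refine le_trans (mul_nonpos_of_nonpos_of_nonneg (by linarith) (by positivity))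
        (Nat.cast_nonneg _)
    · calc ((T : ℝ) - N) * (N * (N + 1) / 2)
          ≤ ((Finset.Icc (N + 1) T).card : ℝ) * (N * (N + 1) / 2) := by
            rw [Nat.card_Icc, Nat.add_sub_add_right, Nat.cast_sub h]
        _ = ∑ t ∈ Finset.Icc (N + 1) T, ((N : ℝ) * (N + 1) / 2) := by
            rw [Finset.sum_const, nsmul_eq_mul]
        _ ≤ ∑ t ∈ Finset.Icc (N + 1) T, ((∑ n : Fin N, π.aoi L h₀ n t ω : ℕ) : ℝ) := by
            refine Finset.sum_le_sum fun t ht => ?_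
            have h1 := le_sum_aoi π L h₀ (t := t)
              ((Nat.le_succ N).trans (Finset.mem_Icc.1 ht).1) ω
            have h2 : (N : ℝ) * (N + 1) ≤ ((∑ n : Fin N, π.aoi L h₀ n t ω : ℕ) : ℝ) * 2 := by
              exact_mod_cast h1
            linarith
        _ ≤ ∑ t ∈ Finset.Icc 1 T, ((∑ n : Fin N, π.aoi L h₀ n t ω : ℕ) : ℝ) :=
            Finset.sum_le_sum_of_subset_of_nonneg
              (Finset.Icc_subset_Icc_left (Nat.le_add_left 1 N))
              fun t _ _ => Nat.cast_nonneg _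
        _ = _ := by rw [Nat.cast_sum]
  have hrepr : π.avgAoI L h₀ T ω = ENNReal.ofReal
      (((∑ t ∈ Finset.Icc 1 T, ∑ n : Fin N, π.aoi L h₀ n t ω : ℕ) : ℝ) / (T * N)) := by
    rw [ENNReal.ofReal_div_of_pos (by positivity), ENNReal.ofReal_natCast,
      ENNReal.ofReal_mul hT'.le, ENNReal.ofReal_natCast, ENNReal.ofReal_natCast, avgAoI]
    push_cast
    rfl
  rw [hrepr]
  refine ENNReal.ofReal_le_ofReal ?_
  rw [le_div_iff₀ (by positivity)]
  refine le_trans (le_of_eq ?_) key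
  field_simp

theorem le_timeAvgAoI [MeasurableSpace Ω] (π : Policy N Ω) (μ : Measure Ω)
    [IsProbabilityMeasure μ] (L : Fin N → ℕ → Ω → Bool) (h₀ : Fin N → ℕ) (hN : 0 < N) :
    ENNReal.ofReal ((N + 1) / 2) ≤ π.timeAvgAoI μ L h₀ := by
  have hlim : Tendsto (fun T : ℕ => ENNReal.ofReal (((T : ℝ) - N) / T * ((N + 1) / 2))) atTop
      (𝓝 (ENNReal.ofReal ((N + 1) / 2))) := by
    refine ENNReal.tendsto_ofReal ?_
    have h1 : Tendsto (fun T : ℕ => (1 - (N : ℝ) / T) * ((N + 1) / 2)) atTop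
        (𝓝 ((1 - 0) * (((N : ℝ) + 1) / 2))) :=
      (tendsto_const_nhds.sub (tendsto_const_div_atTop_nhds_zero_nat _)).mul tendsto_const_nhds
    rw [sub_zero, one_mul] at h1
    refine h1.congr' ?_
    filter_upwards [eventually_gt_atTop 0] with T hT
    have : (T : ℝ) ≠ 0 := by exact_mod_cast hT.ne'
    field_simp
  rw [← hlim.limsup_eq, timeAvgAoI]
  refine limsup_le_limsup ?_
  filter_upwards [eventually_gt_atTop 0] with T hT
  calc _ = ∫⁻ _, ENNReal.ofReal (((T : ℝ) - N) / T * ((N + 1) / 2)) ∂μ := by simp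
    _ ≤ _ := lintegral_mono fun ω => le_avgAoI π L h₀ hN hT ω

end Policy

/-! ### Upper bound: round robin with the freshest packet -/

section RoundRobin

variable {N : ℕ} {Ω : Type*}

/-- The slot of the last arrival at terminal `n` before slot `t` (`0` if there is none). -/
def lastArrival (L : Fin N → ℕ → Ω → Bool) (n : Fin N) : ℕ → Ω → ℕ
  | 0, _ => 0
  | t + 1, ω => if L n t ω = true then t else lastArrival L n t ω

/-- The age, at time `t`, of the freshest packet that arrived at terminal `n`; as long as there is
none, the age of the initial status. -/
def freshAge (L : Fin N → ℕ → Ω → Bool) (h₀ : Fin N → ℕ) (n : Fin N) : ℕ → Ω → ℕ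
  | 0, _ => h₀ n
  | t + 1, ω => (if L n t ω = true then 0 else freshAge L h₀ n t ω) + 1

/-- The terminals are scheduled cyclically; each stores and transmits its freshest packet only. -/
def roundRobin (L : Fin N → ℕ → Ω → Bool) : Policy N Ω where
  sched n t _ := decide (t % N = n)
  packet n t ω := lastArrival L n t ω
  keep n t ω := {lastArrival L n (t + 1) ω}

theorem roundRobin_success_iff {L : Fin N → ℕ → Ω → Bool} {n : Fin N} {t : ℕ} {ω : Ω} :
    (roundRobin L).Success n t ω ↔ t % N = n := by
  simp only [Policy.Success, roundRobin, decide_eq_true_eq, decide_eq_false_iff_not,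
    and_iff_left_iff_imp]
  intro h m hm h'
  exact hm (Fin.ext (h'.symm.trans h))

theorem roundRobin_queue_subset (L : Fin N → ℕ → Ω → Bool) (n : Fin N) (t : ℕ) (ω : Ω) :
    (roundRobin L).queue L n t ω ⊆ {lastArrival L n t ω} := by
  cases t with
  | zero => exact Set.empty_subset _
  | succ t => exact fun s hs => hs.2

theorem roundRobin_respectsBuffer (L : Fin N → ℕ → Ω → Bool) {B : ℕ∞} (hB : 1 ≤ B) :
    (roundRobin L).RespectsBuffer L B := fun n t ω =>
  ((Set.encard_le_encard (roundRobin_queue_subset L n t ω)).trans_eq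
    (Set.encard_singleton _)).trans hB

/-- Invariant: either the base station is already as fresh as the newest arrival, or that packet
still waits in the queue. It leaves only by delivery, which restores the first alternative, or when
a newer packet replaces it. -/
theorem roundRobin_aoi_or (L : Fin N → ℕ → Ω → Bool) (h₀ : Fin N → ℕ) (n : Fin N) (t : ℕ)
    (ω : Ω) : (roundRobin L).aoi L h₀ n t ω ≤ freshAge L h₀ n t ω ∨
      (lastArrival L n t ω ∈ (roundRobin L).queue L n t ω ∧
        t - lastArrival L n t ω ≤ freshAge L h₀ n t ω) := by
  induction t with
  | zero => exact Or.inl le_rfl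
  | succ t ih =>
    by_cases hL : L n t ω = true
    · right
      have hlast : lastArrival L n (t + 1) ω = t := by simp [lastArrival, hL]
      rw [hlast]
      refine ⟨⟨Or.inr ⟨rfl, hL⟩, ?_⟩, ?_⟩
      · exact hlast.symm
      · simp [freshAge]
    · have hlast : lastArrival L n (t + 1) ω = lastArrival L n t ω := by simp [lastArrival, hL]
      have hage : freshAge L h₀ n (t + 1) ω = freshAge L h₀ n t ω + 1 := by simp [freshAge, hL]
      rw [hlast, hage]
      rcases ih with ih | ⟨hq, ih⟩
      · exact Or.inl ((Policy.aoi_succ_le _ L h₀ n t ω).trans (by omega))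
      · by_cases hs : (roundRobin L).Success n t ω
        · left
          rw [Policy.aoi_succ_of_success hs hq]
          exact Nat.add_le_add_right ((min_le_right _ _).trans ih) 1
        · exact Or.inr ⟨⟨Or.inl ⟨hq, fun h => hs h.1⟩, hlast.symm⟩, by omega⟩

theorem roundRobin_aoi_succ_le (L : Fin N → ℕ → Ω → Bool) (h₀ : Fin N → ℕ) {n : Fin N} {t : ℕ}
    (ht : t % N = n) (ω : Ω) :
    (roundRobin L).aoi L h₀ n (t + 1) ω ≤ freshAge L h₀ n t ω + 1 := by
  rcases roundRobin_aoi_or L h₀ n t ω with h | ⟨hq, h⟩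
  · exact (Policy.aoi_succ_le _ L h₀ n t ω).trans (by omega)
  · rw [Policy.aoi_succ_of_success (roundRobin_success_iff.2 ht) hq]
    exact Nat.add_le_add_right ((min_le_right _ _).trans h) 1

/-! ### Service times of the cyclic schedule -/

/-- The time since the last slot before time `t` that is assigned to terminal `n`, when the cyclic
schedule is extended to negative times. -/
def serviceAge (N n t : ℕ) : ℕ := (t + (N - 1 - n)) % N + 1

theorem serviceAge_succ {n t : ℕ} (hn : n < N) :
    serviceAge N n (t + 1) = if t % N = n then 1 else serviceAge N n t + 1 := by
  unfold serviceAge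
  have hr := Nat.mod_lt t (by omega : 0 < N)
  have h1 : (t + 1 + (N - 1 - n)) % N = (t % N + 1 + (N - 1 - n)) % N := by
    rw [add_assoc, add_assoc, Nat.mod_add_mod]
  have h2 : (t + (N - 1 - n)) % N = (t % N + (N - 1 - n)) % N := by rw [Nat.mod_add_mod]
  rw [h1, h2]
  -- Only the residue `r` matters: neither sum wraps around for `r < n`, and both wrap exactly once
  -- for `r > n`.
  generalize t % N = r at hr
  split_ifs with h
  · subst h
    rw [show r + 1 + (N - 1 - r) = N by omega, Nat.mod_self]
  · rcases lt_or_gt_of_ne h with h | h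
    · rw [Nat.mod_eq_of_lt (by omega), Nat.mod_eq_of_lt (by omega)]
      omega
    · rw [Nat.mod_eq_sub_mod (by omega), Nat.mod_eq_sub_mod (a := r + (N - 1 - n)) (by omega),
        Nat.mod_eq_of_lt (by omega), Nat.mod_eq_of_lt (by omega)]
      omega

theorem serviceAge_le {n t : ℕ} (hn : n < N) : serviceAge N n t ≤ N :=
  Nat.mod_lt _ (by omega)

/-- At every time the shifted residues permute `Fin N`, so the service ages are `1, ..., N` in some
order. -/
theorem sum_serviceAge_mul_two (N t : ℕ) :
    (∑ n : Fin N, serviceAge N n t) * 2 = N * (N + 1) := by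
  rcases Nat.eq_zero_or_pos N with rfl | hN
  · simp
  let f : Fin N → Fin N := fun n => ⟨(t + (N - 1 - n)) % N, Nat.mod_lt _ hN⟩
  have hf : Function.Injective f := by
    intro n m h
    have h1 : (t + (N - 1 - n)) ≡ (t + (N - 1 - m)) [MOD N] := congrArg Fin.val h
    have h2 := (Nat.ModEq.add_left_cancel' t h1).eq_of_lt_of_lt (by omega) (by omega)
    exact Fin.ext (by omega)
  have h1 : ∑ n : Fin N, serviceAge N n t = ∑ n : Fin N, ((n : ℕ) + 1) :=
    (Finite.injective_iff_bijective.1 hf).sum_comp fun n : Fin N => (n : ℕ) + 1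
  have h2 := Finset.sum_range_id_mul_two (N + 1)
  rw [Finset.sum_range_succ'] at h2
  rw [h1, Fin.sum_univ_eq_sum_range fun n => n + 1]
  simpa [mul_comm] using h2

/-- The last service took place in slot `t - serviceAge N n t`. Before the first service the
truncated subtraction gives 0, where `freshAge` is the initial AoI. -/
theorem roundRobin_aoi_le (L : Fin N → ℕ → Ω → Bool) (h₀ : Fin N → ℕ) (n : Fin N) (t : ℕ)
    (ω : Ω) : (roundRobin L).aoi L h₀ n t ω
      ≤ freshAge L h₀ n (t - serviceAge N n t) ω + serviceAge N n t := by
  induction t with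
  | zero => simp [Policy.aoi, freshAge]
  | succ t ih =>
    rw [serviceAge_succ n.2]
    split_ifs with h
    · exact roundRobin_aoi_succ_le L h₀ h ω
    · rw [Nat.add_sub_add_right]
      exact (Policy.aoi_succ_le _ L h₀ n t ω).trans (Nat.add_le_add_right ih 1)

/-! ### Causality of round robin -/

/-- The information about the arrivals from slot `t` on. -/
abbrev futureArrivals (L : Fin N → ℕ → Ω → Bool) (t : ℕ) : MeasurableSpace Ω :=
  ⨆ n : Fin N, ⨆ s : ℕ, ⨆ _ : t ≤ s, MeasurableSpace.comap (L n s) inferInstance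

variable [mΩ : MeasurableSpace Ω]

/-- The information about all arrivals before slot `t`. -/
def arrivalFiltration (L : Fin N → ℕ → Ω → Bool) (hL : ∀ n t, Measurable (L n t)) :
    Filtration ℕ mΩ where
  seq t := ⨆ p ∈ {p : Fin N × ℕ | p.2 < t}, MeasurableSpace.comap (L p.1 p.2) inferInstance
  mono' _ _ hst := biSup_mono fun _ hp => lt_of_lt_of_le hp hst
  le' _ := iSup₂_le fun p _ => (hL p.1 p.2).comap_le

theorem measurable_arrivalFiltration {L : Fin N → ℕ → Ω → Bool}
    (hL : ∀ n t, Measurable (L n t)) (n : Fin N) {s t : ℕ} (hst : s < t) :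
    Measurable[arrivalFiltration L hL t] (L n s) :=
  measurable_iff_comap_le.2 (le_iSup₂_of_le (n, s) hst le_rfl)

theorem indep_arrivalFiltration {L : Fin N → ℕ → Ω → Bool} (hL : ∀ n t, Measurable (L n t))
    {μ : Measure Ω} (hindep : iIndepFun (fun p : Fin N × ℕ => L p.1 p.2) μ) (t : ℕ) :
    Indep (arrivalFiltration L hL t) (futureArrivals L t) μ := by
  have h := indep_iSup_of_disjoint (fun p : Fin N × ℕ => (hL p.1 p.2).comap_le) hindep
    (S := {p | p.2 < t}) (T := {p | t ≤ p.2})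
    (Set.disjoint_left.2 fun p hp hp' => not_le_of_gt (α := ℕ) hp hp')
  refine indep_of_indep_of_le_right h ?_
  exact iSup_le fun n => iSup_le fun s => iSup_le fun hs => le_iSup₂_of_le (n, s) hs le_rfl

theorem measurable_lastArrival {L : Fin N → ℕ → Ω → Bool} (hL : ∀ n t, Measurable (L n t))
    (n : Fin N) (t : ℕ) : Measurable[arrivalFiltration L hL t] (lastArrival L n t) := by
  induction t with
  | zero => exact @measurable_const _ _ _ (arrivalFiltration L hL 0) 0
  | succ t ih =>
    exact Measurable.ite
      (measurable_arrivalFiltration hL n t.lt_succ_self (measurableSet_singleton true))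
      measurable_const (ih.mono ((arrivalFiltration L hL).mono t.le_succ) le_rfl)

theorem measurable_freshAge {L : Fin N → ℕ → Ω → Bool} (hL : ∀ n t, Measurable (L n t))
    (h₀ : Fin N → ℕ) (n : Fin N) (t : ℕ) :
    Measurable[arrivalFiltration L hL t] (freshAge L h₀ n t) := by
  induction t with
  | zero => exact @measurable_const _ _ _ (arrivalFiltration L hL 0) (h₀ n)
  | succ t ih =>
    exact (measurable_from_top (f := fun k : ℕ => k + 1)).comp (Measurable.ite
      (measurable_arrivalFiltration hL n t.lt_succ_self (measurableSet_singleton true))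
      measurable_const (ih.mono ((arrivalFiltration L hL).mono t.le_succ) le_rfl))

theorem roundRobin_causal {L : Fin N → ℕ → Ω → Bool} (hL : ∀ n t, Measurable (L n t))
    {μ : Measure Ω} (hindep : iIndepFun (fun p : Fin N × ℕ => L p.1 p.2) μ) :
    (roundRobin L).Causal μ L := by
  refine ⟨arrivalFiltration L hL, fun n s t hst => measurable_arrivalFiltration hL n hst,
    indep_arrivalFiltration hL hindep, fun n t => ⟨?_, measurable_lastArrival hL n t, fun s => ?_⟩⟩
  · exact @measurable_const _ _ _ (arrivalFiltration L hL t) (decide (t % N = n))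
  · have h := measurable_lastArrival hL n (t + 1) (measurableSet_singleton s)
    convert h using 1
    ext ω
    exact eq_comm

/-! ### Expected age under round robin -/

/-- The arrival in slot `t` is independent of the past, so the mean obeys `x ↦ (1 - r) * x + 1`. Its
fixed point is `1 / r`, and deviations shrink by `1 - r`. -/
theorem lintegral_freshAge_le {L : Fin N → ℕ → Ω → Bool} (hL : ∀ n t, Measurable (L n t))
    {μ : Measure Ω} [IsProbabilityMeasure μ]
    (hindep : iIndepFun (fun p : Fin N × ℕ => L p.1 p.2) μ) {n : Fin N} {r : ℝ} (hr : 0 < r)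
    (hr1 : r ≤ 1) (hbern : ∀ t, μ {ω | L n t ω = true} = ENNReal.ofReal r) (h₀ : Fin N → ℕ)
    (t : ℕ) : ∫⁻ ω, (freshAge L h₀ n t ω : ℝ≥0∞) ∂μ
      ≤ ENNReal.ofReal (1 / r + (1 - r) ^ t * h₀ n) := by
  have hr' : 0 ≤ 1 - r := by linarith
  induction t with
  | zero =>
    simp only [freshAge, lintegral_const, measure_univ, mul_one, pow_zero, one_mul]
    rw [← ENNReal.ofReal_natCast]
    exact ENNReal.ofReal_le_ofReal (le_add_of_nonneg_left (by positivity))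
  | succ t ih =>
    set A : Set Ω := {ω | L n t ω = true} with hA
    have hAm : MeasurableSet A := hL n t (measurableSet_singleton true)
    have hAc : μ Aᶜ = ENNReal.ofReal (1 - r) := by
      rw [prob_compl_eq_one_sub hAm, hbern t, ENNReal.ofReal_sub _ hr.le, ENNReal.ofReal_one]
    have hG : futureArrivals L t ≤ mΩ :=
      iSup_le fun n => iSup_le fun s => iSup_le fun _ => (hL n s).comap_le
    have hLG : Measurable[futureArrivals L t] (L n t) := measurable_iff_comap_le.2
      (le_iSup_of_le n (le_iSup_of_le t (le_iSup_of_le le_rfl le_rfl)))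
    have hAG : MeasurableSet[futureArrivals L t] Aᶜ := (hLG (measurableSet_singleton true)).compl
    have hF : Measurable[arrivalFiltration L hL t]
        (fun ω => (freshAge L h₀ n t ω : ℝ≥0∞)) :=
      measurable_from_top.comp (measurable_freshAge hL h₀ n t)
    have hmul := lintegral_mul_eq_lintegral_mul_lintegral_of_independent_measurableSpace
      ((arrivalFiltration L hL).le t) hG (indep_arrivalFiltration hL hindep t) hF
      ((@measurable_const _ _ _ (futureArrivals L t) (1 : ℝ≥0∞)).indicator hAG)
    rw [lintegral_indicator hAm.compl, setLIntegral_const, one_mul, hAc] at hmul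
    have hpt : ∀ ω, (freshAge L h₀ n (t + 1) ω : ℝ≥0∞)
        = (freshAge L h₀ n t ω : ℝ≥0∞) * Aᶜ.indicator (fun _ => 1) ω + 1 := by
      intro ω
      by_cases h : L n t ω = true <;> simp [freshAge, hA, h]
    simp only [hpt]
    rw [lintegral_add_right _ measurable_const, hmul, lintegral_const, measure_univ, mul_one]
    calc _ ≤ ENNReal.ofReal (1 / r + (1 - r) ^ t * h₀ n) * ENNReal.ofReal (1 - r)
            + ENNReal.ofReal 1 := by rw [ENNReal.ofReal_one]; gcongr
      _ = _ := by
        rw [← ENNReal.ofReal_mul (by positivity), ← ENNReal.ofReal_add (by positivity) zero_le_one]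
        congr 1
        field_simp
        ring

theorem lintegral_sum_roundRobin_aoi_le {L : Fin N → ℕ → Ω → Bool}
    (hL : ∀ n t, Measurable (L n t)) {μ : Measure Ω} [IsProbabilityMeasure μ]
    (hindep : iIndepFun (fun p : Fin N × ℕ => L p.1 p.2) μ) {rate : Fin N → ℝ}
    (hrate : ∀ n, 0 < rate n ∧ rate n ≤ 1)
    (hbern : ∀ n t, μ {ω | L n t ω = true} = ENNReal.ofReal (rate n)) (h₀ : Fin N → ℕ) (t : ℕ) :
    ∑ n : Fin N, ∫⁻ ω, ((freshAge L h₀ n (t - serviceAge N n t) ω : ℝ≥0∞)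
        + (serviceAge N n t : ℝ≥0∞)) ∂μ
      ≤ ENNReal.ofReal ((N : ℝ) * (N + 1) / 2 + ∑ n, 1 / rate n
          + ∑ n, (1 - rate n) ^ (t - N) * h₀ n) := by
  have h1 : ∀ n, 0 ≤ 1 - rate n := fun n => by linarith [(hrate n).2]
  have h0 : ∀ n, 0 ≤ 1 / rate n := fun n => one_div_nonneg.2 (hrate n).1.le
  have h2 : ∀ n, 0 ≤ (1 - rate n) ^ (t - N) * (h₀ n : ℝ) := fun n =>
    mul_nonneg (pow_nonneg (h1 n) _) (Nat.cast_nonneg _)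
  have hS : (N : ℝ) * (N + 1) / 2 = ∑ n : Fin N, (serviceAge N n t : ℝ) := by
    have : ((∑ n : Fin N, serviceAge N n t : ℕ) : ℝ) * 2 = N * (N + 1) := by
      exact_mod_cast sum_serviceAge_mul_two N t
    push_cast at this
    linarith
  rw [hS, ← Finset.sum_add_distrib, ← Finset.sum_add_distrib, ENNReal.ofReal_sum_of_nonneg
    fun n _ => add_nonneg (add_nonneg (Nat.cast_nonneg _) (h0 n)) (h2 n)]
  refine Finset.sum_le_sum fun n _ => ?_
  rw [lintegral_add_right _ measurable_const, lintegral_const, measure_univ, mul_one, add_assoc,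
    ENNReal.ofReal_add (Nat.cast_nonneg _) (add_nonneg (h0 n) (h2 n)), ENNReal.ofReal_natCast,
    add_comm]
  gcongr
  refine (lintegral_freshAge_le hL hindep (hrate n).1 (hrate n).2 (hbern n) h₀ _).trans ?_
  refine ENNReal.ofReal_le_ofReal ?_
  gcongr (1 / rate n + ?_ * (h₀ n : ℝ))
  -- A service age is at most `N`, so the exponent `t - N` serves all terminals.
  exact pow_le_pow_of_le_one (h1 n) (by linarith [(hrate n).1])
    (Nat.sub_le_sub_left (serviceAge_le n.2) t)

theorem roundRobin_timeAvgAoI_le {L : Fin N → ℕ → Ω → Bool}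
    (hL : ∀ n t, Measurable (L n t)) {μ : Measure Ω} [IsProbabilityMeasure μ]
    (hindep : iIndepFun (fun p : Fin N × ℕ => L p.1 p.2) μ) {rate : Fin N → ℝ}
    (hrate : ∀ n, 0 < rate n ∧ rate n ≤ 1)
    (hbern : ∀ n t, μ {ω | L n t ω = true} = ENNReal.ofReal (rate n)) (h₀ : Fin N → ℕ)
    (hN : 0 < N) :
    (roundRobin L).timeAvgAoI μ L h₀
      ≤ ENNReal.ofReal (((N : ℝ) * (N + 1) / 2 + ∑ n, 1 / rate n) / N) := by
  have hN' : (0 : ℝ) < N := by exact_mod_cast hN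
  set K : ℝ := (N : ℝ) * (N + 1) / 2 + ∑ n, 1 / rate n with hK
  have h1 : ∀ n, 0 ≤ 1 - rate n := fun n => by linarith [(hrate n).2]
  have hK0 : 0 ≤ K := add_nonneg (by positivity)
    (Finset.sum_nonneg fun n _ => one_div_nonneg.2 (hrate n).1.le)
  set g : ℕ → ℝ := fun t => K + ∑ n, (1 - rate n) ^ (t - N) * h₀ n with hg
  have hg0 : ∀ t, 0 ≤ g t := fun t => add_nonneg hK0
    (Finset.sum_nonneg fun n _ => mul_nonneg (pow_nonneg (h1 n) _) (Nat.cast_nonneg _))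
  have hglim : Tendsto g atTop (𝓝 K) := by
    have : Tendsto g atTop (𝓝 (K + ∑ n : Fin N, 0 * (h₀ n : ℝ))) :=
      tendsto_const_nhds.add (tendsto_finsetSum _ fun n _ =>
        ((tendsto_pow_atTop_nhds_zero_of_lt_one (h1 n) (by linarith [(hrate n).1])).comp
          (tendsto_sub_atTop_nat N)).mul_const _)
    simpa using this
  -- The transient in `g` vanishes, so the Cesàro means of `g` converge to `K`.
  have hces : Tendsto (fun T : ℕ => ENNReal.ofReal
      (((T : ℝ)⁻¹ * ∑ i ∈ Finset.range T, g (i + 1)) / N)) atTop (𝓝 (ENNReal.ofReal (K / N))) :=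
    ENNReal.tendsto_ofReal ((hglim.comp (tendsto_add_atTop_nat 1)).cesaro.div_const _)
  rw [← hces.limsup_eq, Policy.timeAvgAoI]
  refine limsup_le_limsup ?_
  filter_upwards [eventually_gt_atTop 0] with T hT
  have hT' : (0 : ℝ) < T := by exact_mod_cast hT
  have hF : ∀ (n : Fin N) (t : ℕ), Measurable fun ω =>
      (freshAge L h₀ n (t - serviceAge N n t) ω : ℝ≥0∞) + (serviceAge N n t : ℝ≥0∞) := fun n t =>
    ((measurable_from_top (f := fun k : ℕ => (k : ℝ≥0∞))).comp
      ((measurable_freshAge hL h₀ n _).mono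
      ((arrivalFiltration L hL).le _) le_rfl)).add measurable_const
  -- The AoI is first replaced by its majorant, whose measurability allows exchanging sums and
  -- integral.
  calc ∫⁻ ω, (roundRobin L).avgAoI L h₀ T ω ∂μ
      ≤ ∫⁻ ω, (∑ t ∈ Finset.Icc 1 T, ∑ n : Fin N,
          ((freshAge L h₀ n (t - serviceAge N n t) ω : ℝ≥0∞) + (serviceAge N n t : ℝ≥0∞)))
            / ((T : ℝ≥0∞) * (N : ℝ≥0∞)) ∂μ := by
        refine lintegral_mono fun ω => ENNReal.div_le_div_right ?_ _
        refine Finset.sum_le_sum fun t _ => Finset.sum_le_sum fun n _ => ?_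
        exact_mod_cast roundRobin_aoi_le L h₀ n t ω
    _ = (∑ t ∈ Finset.Icc 1 T, ∑ n : Fin N,
          ∫⁻ ω, ((freshAge L h₀ n (t - serviceAge N n t) ω : ℝ≥0∞)
            + (serviceAge N n t : ℝ≥0∞)) ∂μ) / ((T : ℝ≥0∞) * (N : ℝ≥0∞)) := by
        simp only [div_eq_mul_inv]
        rw [lintegral_mul_const _ (Finset.measurable_sum _ fun t _ =>
            Finset.measurable_sum _ fun n _ => hF n t),
          lintegral_finsetSum _ fun t _ => Finset.measurable_sum _ fun n _ => hF n t]
        congr 1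
        exact Finset.sum_congr rfl fun t _ => lintegral_finsetSum _ fun n _ => hF n t
    _ ≤ (∑ t ∈ Finset.Icc 1 T, ENNReal.ofReal (g t)) / ((T : ℝ≥0∞) * (N : ℝ≥0∞)) :=
        ENNReal.div_le_div_right (Finset.sum_le_sum fun t _ =>
          lintegral_sum_roundRobin_aoi_le hL hindep hrate hbern h₀ t) _
    _ = ENNReal.ofReal (((T : ℝ)⁻¹ * ∑ i ∈ Finset.range T, g (i + 1)) / N) := by
        have hsum : ∑ i ∈ Finset.range T, g (i + 1) = ∑ t ∈ Finset.Icc 1 T, g t := by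
          rw [Finset.range_eq_Ico, Finset.sum_Ico_add' g 0 T 1, zero_add]
          rfl
        rw [hsum, show ((T : ℝ)⁻¹ * ∑ t ∈ Finset.Icc 1 T, g t) / N
            = (∑ t ∈ Finset.Icc 1 T, g t) / (T * N) by field_simp,
          ENNReal.ofReal_div_of_pos (by positivity), ENNReal.ofReal_mul hT'.le,
          ENNReal.ofReal_natCast, ENNReal.ofReal_natCast,
          ENNReal.ofReal_sum_of_nonneg fun t _ => hg0 t]

end RoundRobin

/-! ### Bounds on the two minima and the scaling limit -/

theorem le_minAoINonCausal {Ω : Type*} [MeasurableSpace Ω] (μ : Measure Ω)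
    [IsProbabilityMeasure μ] {N : ℕ} (hN : 0 < N) (L : Fin N → ℕ → Ω → Bool) (h₀ : Fin N → ℕ)
    (B : ℕ∞) : ENNReal.ofReal ((N + 1) / 2) ≤ minAoINonCausal μ N L h₀ B :=
  le_iInf fun π => π.1.le_timeAvgAoI μ L h₀ hN

theorem Policy.Causal.arbitrary {Ω : Type*} [MeasurableSpace Ω] {μ : Measure Ω} {N : ℕ}
    {L : Fin N → ℕ → Ω → Bool} {π : Policy N Ω} (h : π.Causal μ L) : π.Arbitrary := by
  obtain ⟨𝓕, -, -, h⟩ := h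
  exact fun n t => ⟨(h n t).1.mono (𝓕.le t) le_rfl, (h n t).2.1.mono (𝓕.le t) le_rfl,
    fun s => 𝓕.le (t + 1) _ ((h n t).2.2 s)⟩

theorem minAoINonCausal_le_minAoI {Ω : Type*} [MeasurableSpace Ω] (μ : Measure Ω) (N : ℕ)
    (L : Fin N → ℕ → Ω → Bool) (h₀ : Fin N → ℕ) (B : ℕ∞) :
    minAoINonCausal μ N L h₀ B ≤ minAoI μ N L h₀ B :=
  le_iInf fun π => iInf_le_of_le ⟨π.1, π.2.1, π.2.2.arbitrary⟩ le_rfl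

theorem minAoI_le {Ω : Type*} [MeasurableSpace Ω] {μ : Measure Ω} [IsProbabilityMeasure μ]
    {N : ℕ} (hN : 0 < N) {L : Fin N → ℕ → Ω → Bool} (hL : ∀ n t, Measurable (L n t))
    (hindep : iIndepFun (fun p : Fin N × ℕ => L p.1 p.2) μ) {rate : Fin N → ℝ}
    (hrate : ∀ n, 0 < rate n ∧ rate n ≤ 1)
    (hbern : ∀ n t, μ {ω | L n t ω = true} = ENNReal.ofReal (rate n)) (h₀ : Fin N → ℕ) {B : ℕ∞}
    (hB : 1 ≤ B) :
    minAoI μ N L h₀ B ≤ ENNReal.ofReal (((N : ℝ) * (N + 1) / 2 + ∑ n, 1 / rate n) / N) :=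
  iInf_le_of_le ⟨roundRobin L, roundRobin_respectsBuffer L hB, roundRobin_causal hL hindep⟩
    (roundRobin_timeAvgAoI_le hL hindep hrate hbern h₀ hN)

end AoI

theorem corollary1 {Ω : Type*} [MeasurableSpace Ω] (μ : Measure Ω) [IsProbabilityMeasure μ]
    -- arrival rates of the terminals
    (rate : ℕ → ℝ) (hrate : ∀ n, 0 < rate n ∧ rate n ≤ 1)
    -- the mean expected inter-arrival time over the first `N` terminals is `o(N)`
    (hmean : Tendsto (fun N : ℕ => ((∑ n ∈ Finset.range N, 1 / rate n) / N) / N) atTop (𝓝 0))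
    -- Bernoulli arrivals, independent over terminals and slots
    (L : ℕ → ℕ → Ω → Bool) (hL : ∀ n t, Measurable (L n t))
    (hindep : iIndepFun (fun p : ℕ × ℕ => L p.1 p.2) μ)
    (hbern : ∀ n t, μ {ω | L n t ω = true} = ENNReal.ofReal (rate n))
    -- initial values of the AoI, and the buffer size
    (h₀ : ℕ → ℕ) (B : ℕ∞) (hB : 1 ≤ B) :
    Tendsto (fun N : ℕ =>
      AoI.minAoI μ N (fun n => L n) (fun n => h₀ n) B / (N : ℝ≥0∞)) atTop (𝓝 (1 / 2)) ∧
    Tendsto (fun N : ℕ =>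
      AoI.minAoINonCausal μ N (fun n => L n) (fun n => h₀ n) B / (N : ℝ≥0∞)) atTop
        (𝓝 (1 / 2)) := by
  have hlow : ∀ N : ℕ, 0 < N → 1 / 2 ≤
      AoI.minAoINonCausal μ N (fun n => L n) (fun n => h₀ n) B / (N : ℝ≥0∞) := by
    intro N hN
    have hN' : (0 : ℝ) < N := by exact_mod_cast hN
    calc (1 / 2 : ℝ≥0∞) = ENNReal.ofReal (1 / 2) := by
          rw [ENNReal.ofReal_div_of_pos two_pos, ENNReal.ofReal_one, ENNReal.ofReal_ofNat]
      _ ≤ ENNReal.ofReal (((N : ℝ) + 1) / 2 / N) := by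
          refine ENNReal.ofReal_le_ofReal ?_
          rw [le_div_iff₀ hN']
          linarith
      _ = ENNReal.ofReal (((N : ℝ) + 1) / 2) / (N : ℝ≥0∞) := by
          rw [ENNReal.ofReal_div_of_pos hN', ENNReal.ofReal_natCast]
      _ ≤ _ := ENNReal.div_le_div_right (AoI.le_minAoINonCausal μ hN _ _ B) _
  have hmid : ∀ N : ℕ, AoI.minAoINonCausal μ N (fun n => L n) (fun n => h₀ n) B / (N : ℝ≥0∞)
      ≤ AoI.minAoI μ N (fun n => L n) (fun n => h₀ n) B / (N : ℝ≥0∞) := fun N =>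
    ENNReal.div_le_div_right (AoI.minAoINonCausal_le_minAoI μ N _ _ B) _
  have hup : ∀ N : ℕ, 0 < N → AoI.minAoI μ N (fun n => L n) (fun n => h₀ n) B / (N : ℝ≥0∞)
      ≤ ENNReal.ofReal (1 / 2 + 1 / 2 / N + ((∑ n ∈ Finset.range N, 1 / rate n) / N) / N) := by
    intro N hN
    have hN' : (0 : ℝ) < N := by exact_mod_cast hN
    -- Independence of the full arrival array restricts to the first `N` terminals along this
    -- injection.
    have hinj : Function.Injective fun p : Fin N × ℕ => ((p.1 : ℕ), p.2) := by
      rintro ⟨n, s⟩ ⟨m, t⟩ h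
      simpa [Fin.ext_iff] using h
    have h := AoI.minAoI_le hN (L := fun n : Fin N => L n) (fun n t => hL n t)
      (hindep.precomp hinj) (rate := fun n => rate n) (fun n => hrate n) (fun n t => hbern n t)
      (fun n => h₀ n) hB
    refine (ENNReal.div_le_div_right h _).trans_eq ?_
    rw [Fin.sum_univ_eq_sum_range fun n => 1 / rate n, ← ENNReal.ofReal_natCast N,
      ← ENNReal.ofReal_div_of_pos hN']
    congr 1
    field_simp
  have hlim : Tendsto (fun N : ℕ => ENNReal.ofReal
      (1 / 2 + 1 / 2 / N + ((∑ n ∈ Finset.range N, 1 / rate n) / N) / N)) atTop (𝓝 (1 / 2)) := by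
    have h := ENNReal.tendsto_ofReal (((tendsto_const_nhds (x := (1 / 2 : ℝ))).add
      (tendsto_const_div_atTop_nhds_zero_nat (1 / 2 : ℝ))).add hmean)
    rwa [add_zero, add_zero, ENNReal.ofReal_div_of_pos two_pos, ENNReal.ofReal_one,
      ENNReal.ofReal_ofNat] at h
  constructor
  · refine tendsto_of_tendsto_of_tendsto_of_le_of_le' tendsto_const_nhds hlim ?_ ?_
    · filter_upwards [eventually_gt_atTop 0] with N hN using (hlow N hN).trans (hmid N)
    · filter_upwards [eventually_gt_atTop 0] with N hN using hup N hN
  · refine tendsto_of_tendsto_of_tendsto_of_le_of_le' tendsto_const_nhds hlim ?_ ?_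
    · filter_upwards [eventually_gt_atTop 0] with N hN using hlow N hN
    · filter_upwards [eventually_gt_atTop 0] with N hN using (hmid N).trans (hup N hN)
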